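/- Let $k$ be a commutative ring with unit and $G$ any group; modules are left modules over the group ring $kG$. Let $B(G,\mathbb Z)$ be the $\mathbb ZG$-module of all bounded functions $f:G\to\mathbb Z$, with $(g\cdot f)(x)=f(g^{-1}x)$, and let $B(G,k)=B(G,\mathbb Z)\otimes_{\mathbb Z}k$, where $G$ acts on the first factor. For a $kG$-module $M$ let $G$ act diagonally on $M\otimes_k B(G,k)$, i.e. $g\cdot(m\otimes b)=gm\otimes gb$. Call $M$ cofibrant if $M\otimes_k B(G,k)$ is a projective $kG$-module, and let $\mathrm{Cof}(kG)$ be the class of cofibrant $kG$-modules. For a class $S$ of $kG$-modules put $$S^{\perp}=\{N : \mathrm{Ext}^1_{kG}(M,N)=0 \text{ for all } M\in S\},\qquad {}^{\perp}S=\{M : \mathrm{Ext}^1_{kG}(M,N)=0 \text{ for all } N\in S\}.$$ **Theorem.** Let $U=\mathrm{Cof}(kG)$ and $V=\mathrm{Cof}(kG)^{\perp}$. Then: 1. $(U,V)$ is a cotorsion pair, i.e. $U={}^{\perp}V$ and $U^{\perp}=V$. 2. It is hereditary, i.e. $\mathrm{Ext}^i_{kG}(M,N)=0$ for all $i>0$,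 $M\in U$ and $N\in V$. 3. It is projective, i.e. $U\cap V$ is exactly the class of projective $kG$-modules. 4. It is cogenerated by a set, i.e. there is a set $S$ of $kG$-modules with $V=S^{\perp}$ and $U={}^{\perp}(S^{\perp})$. 5. In particular it is complete, i.e. for every $kG$-module $M$ there are short exact sequences of $kG$-modules $0\to N\to A\to M\to 0$ and $0\to M\to N'\to A'\to 0$ with $A,A'\in U$ and $N,N'\in V$. -/

import Mathlib

universe u v

open CategoryTheory MonoidAlgebra
open scoped TensorProduct

namespace CotorsionPairs

section Modules

variable {R : Type u} [Ring R] [Small.{v} R]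

/-- The left orthogonal of a class `S` of modules: the modules `M` with `Ext¹(M, N) = 0` for all
`N` in `S`. -/
def leftOrthogonal (S : ObjectProperty (ModuleCat.{v} R)) : ObjectProperty (ModuleCat.{v} R) :=
  fun M => ∀ N : ModuleCat.{v} R, S N → Subsingleton (Abelian.Ext M N 1)

/-- The right orthogonal of a class `S` of modules: the modules `N` with `Ext¹(M, N) = 0` for all
`M` in `S`. -/
def rightOrthogonal (S : ObjectProperty (ModuleCat.{v} R)) : ObjectProperty (ModuleCat.{v} R) :=
  fun N => ∀ M : ModuleCat.{v} R, S M → Subsingleton (Abelian.Ext M N 1)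

/-- `(U, V)` is a cotorsion pair. -/
def IsCotorsionPair (U V : ObjectProperty (ModuleCat.{v} R)) : Prop :=
  U = leftOrthogonal V ∧ rightOrthogonal U = V

/-- The pair `(U, V)` is hereditary: all positive Ext-groups from `U` to `V` vanish. -/
def IsHereditary (U V : ObjectProperty (ModuleCat.{v} R)) : Prop :=
  ∀ M N : ModuleCat.{v} R, U M → V N → ∀ i : ℕ, 0 < i → Subsingleton (Abelian.Ext M N i)

/-- The pair `(U, V)` is complete: each module `M` is the end term of a short exact sequence
`0 ⟶ B ⟶ A ⟶ M ⟶ 0` and the first term of a short exact sequence `0 ⟶ M ⟶ B ⟶ A ⟶ 0`,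
in both cases with `A` in `U` and `B` in `V`. -/
def IsComplete (U V : ObjectProperty (ModuleCat.{v} R)) : Prop :=
  ∀ M : ModuleCat.{v} R,
    (∃ (A B : ModuleCat.{v} R) (f : B ⟶ A) (g : A ⟶ M) (w : f ≫ g = 0),
      U A ∧ V B ∧ (ShortComplex.mk f g w).ShortExact) ∧
    (∃ (A B : ModuleCat.{v} R) (f : M ⟶ B) (g : B ⟶ A) (w : f ≫ g = 0),
      U A ∧ V B ∧ (ShortComplex.mk f g w).ShortExact)

/-- The pair `(U, V)` is projective: its kernel `U ∩ V` is the class of projective modules. -/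
def IsProjectivePair (U V : ObjectProperty (ModuleCat.{v} R)) : Prop :=
  ∀ M : ModuleCat.{v} R, (U M ∧ V M) ↔ Module.Projective R M

/-- The pair `(U, V)` is cogenerated by a set: `V = S^⊥` and `U = ^⊥(S^⊥)` for a family `S` of
modules that is indexed by a set, that is, by a type in the universe of the modules. -/
def IsCogeneratedBySet (U V : ObjectProperty (ModuleCat.{v} R)) : Prop :=
  ∃ (ι : Type v) (S : ι → ModuleCat.{v} R),
    V = rightOrthogonal (ObjectProperty.ofObj S) ∧
      U = leftOrthogonal (rightOrthogonal (ObjectProperty.ofObj S))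

end Modules

noncomputable section Cofibrant

/-- The additive group `B(G, ℤ)` of all bounded functions from `G` to `ℤ`. -/
def boundedFunctions (G : Type v) : Submodule ℤ (G → ℤ) where
  carrier := {f | ∃ C : ℤ, ∀ x, |f x| ≤ C}
  add_mem' := by
    rintro f g ⟨C, hC⟩ ⟨D, hD⟩
    exact ⟨C + D, fun x => (abs_add_le _ _).trans (add_le_add (hC x) (hD x))⟩
  zero_mem' := ⟨0, fun x => by simp⟩
  smul_mem' := by
    rintro n f ⟨C, hC⟩
    refine ⟨|n| * C, fun x => ?_⟩
    simpa [abs_mul] using mul_le_mul_of_nonneg_left (hC x) (abs_nonneg n)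

variable (k : Type u) [CommRing k] (G : Type v) [Group G]

/-- The action of `G` on `B(G, ℤ)` by translation, `(g · f)(x) = f(g⁻¹x)`. -/
def boundedRepInt : Representation ℤ G (boundedFunctions G) where
  toFun g :=
    { toFun := fun f => ⟨fun x => f.1 (g⁻¹ * x), by
        obtain ⟨C, hC⟩ := f.2
        exact ⟨C, fun x => hC _⟩⟩
      map_add' := fun _ _ => rfl
      map_smul' := fun _ _ => rfl }
  map_one' := by
    ext f x
    simp
  map_mul' g h := by
    ext f x
    simp [mul_assoc]

/-- The `k`-linear `G`-representation `B(G, k) = k ⊗_ℤ B(G, ℤ)`, where `g · (a ⊗ f) = a ⊗ gf`. -/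
def boundedRep : Representation k G (k ⊗[ℤ] boundedFunctions G) :=
  ((Module.End.baseChangeHom ℤ k (boundedFunctions G) :
    Module.End ℤ (boundedFunctions G) →ₐ[ℤ] _) : _ →* _).comp (boundedRepInt G)

/-- The class `Cof(kG)` of cofibrant `kG`-modules: those `M` for which `M ⊗_k B(G, k)`, with the
diagonal action `g · (m ⊗ b) = gm ⊗ gb`, is a projective `kG`-module. -/
def Cof : ObjectProperty (ModuleCat.{max u v} k[G]) := fun M =>
  Module.Projective k[G]
    ((Representation.ofModule (k := k) (G := G) M).tprod (boundedRep k G)).asModule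

end Cofibrant

end CotorsionPairs

/-!
# The cotorsion pair of cofibrant modules

Write `B` for `B(G, k)`. Three facts about `B` are used. It is free over `k`: bounded integral
functions on `G` are the locally constant functions on the space of ultrafilters on `G`, so
Nöbeling's theorem applies (`boundedFunctions_free`). Its constant function `1` is invariant, and
evaluation at a point sends it to `1`. It is a ring on which `G` acts by automorphisms.

The key is that cofibrancy is itself a vanishing condition on `Ext¹`. The functor `Hom_k(B, -)`,
with values in modules with the conjugation action, is right adjoint to `- ⊗ B`, and both functors
are exact. Hence `M ⊗ B` is projective if and only if `Ext¹(M, Hom_k(B, N)) = 0` for all `N`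
(`extOneVanishes_conjHom`, `projective_diagTensor_of_extOneVanishes`). So the cofibrant modules are
the left orthogonal of a class, which yields the cotorsion pair and shows that all projective
modules are cofibrant.

* The pair is hereditary because syzygies of cofibrant modules are cofibrant.
* A projective module `P` is a retract of `Hom_k(B, P)`, through evaluation at `1`; hence it is
  right orthogonal to the cofibrant modules (`extOneVanishes_of_projective_right`). Conversely let
  `M` be cofibrant and right orthogonal to the cofibrant modules. The multiplication of `B` shows
  that the cokernel of `M → M ⊗ B`, `m ↦ m ⊗ 1`, is cofibrant. So this map splits, and `M` is
  projective (`projective_of_extOneVanishes_cofibrant`).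
* For the set of test modules, fix a section `s` of the canonical map from the free module on
  `M ⊗ B` onto the projective module `M ⊗ B`. Call `M' ≤ M` support closed if the image of `M' ⊗ B`
  contains the supports of the values of `s` on it. Then `M / M'` is cofibrant. Support closed
  submodules are stable under suprema, and each element of `M` lies in one that has a generating
  family indexed by `List (B × ℕ)`. By Eklof's lemma (`extOneVanishes_of_submodules`), a module
  right orthogonal to the cofibrant quotients of the free module on `List (B × ℕ)` is right
  orthogonal to all cofibrant modules (`extOneVanishes_of_small`).
* Completeness follows from the small object argument, applied to the inclusions of the kernels of
  these quotients (`exists_leftOrthogonal_cover`, `exists_rightOrthogonal_embedding`). Only the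
  lifting properties of the resulting factorizations are needed, since the cofibrant modules are
  already known to be a left orthogonal class.
-/

universe w

namespace CotorsionPairs

/-! ### Vanishing of `Ext¹` and extension of morphisms -/

section Abelian

universe w'

open Limits Abelian MorphismProperty ZeroObject

variable {C : Type u} [Category.{v} C] [Abelian C] [HasExt.{w'} C]

theorem exists_extension_of_ext_one {S : ShortComplex C} (hS : S.ShortExact) {N : C}
    (h : Subsingleton (Ext S.X₃ N 1)) (f : S.X₁ ⟶ N) : ∃ f' : S.X₂ ⟶ N, S.f ≫ f' = f := by
  obtain ⟨x, hx⟩ := Ext.contravariant_sequence_exact₁ hS N (Ext.mk₀ f) (add_zero 1)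
    (Subsingleton.elim _ _)
  obtain ⟨g, rfl⟩ := Ext.addEquiv₀.symm.surjective x
  refine ⟨g, Ext.addEquiv₀.symm.injective ?_⟩
  simpa using hx

theorem ext_one_of_exists_extension {S : ShortComplex C} (hS : S.ShortExact) [Projective S.X₂]
    {N : C} (h : ∀ f : S.X₁ ⟶ N, ∃ f' : S.X₂ ⟶ N, S.f ≫ f' = f) :
    Subsingleton (Ext S.X₃ N 1) := by
  refine subsingleton_of_forall_eq 0 fun x => ?_
  obtain ⟨y, rfl⟩ := Ext.contravariant_sequence_exact₃ hS N x (Ext.eq_zero_of_projective _)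
    (add_zero 1)
  obtain ⟨f, rfl⟩ := Ext.addEquiv₀.symm.surjective y
  obtain ⟨f', rfl⟩ := h f
  simp only [Ext.addEquiv₀_symm_apply]
  rw [← Ext.mk₀_comp_mk₀, ← Ext.comp_assoc (h₁₂ := add_zero 1) (h := rfl), hS.extClass_comp,
    Ext.zero_comp]

theorem exists_lift_of_ext_one {S : ShortComplex C} (hS : S.ShortExact) {M : C}
    (h : Subsingleton (Ext M S.X₁ 1)) (f : M ⟶ S.X₃) : ∃ f' : M ⟶ S.X₂, f' ≫ S.g = f := by
  obtain ⟨x, hx⟩ := Ext.covariant_sequence_exact₃ M hS (Ext.mk₀ f) (zero_add 1)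
    (Subsingleton.elim _ _)
  obtain ⟨g, rfl⟩ := Ext.addEquiv₀.symm.surjective x
  refine ⟨g, Ext.addEquiv₀.symm.injective ?_⟩
  simpa using hx

/-- Dimension shifting along a presentation by a projective object. -/
theorem ext_succ_of_presentation {S : ShortComplex C} (hS : S.ShortExact) [Projective S.X₂]
    {N : C} {n : ℕ} (h : Subsingleton (Ext S.X₁ N n)) : Subsingleton (Ext S.X₃ N (n + 1)) := by
  refine subsingleton_of_forall_eq 0 fun x => ?_
  obtain ⟨y, rfl⟩ := Ext.contravariant_sequence_exact₃ hS N x (Ext.eq_zero_of_projective _)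
    (add_comm 1 n)
  rw [Subsingleton.elim y 0, Ext.comp_zero]

theorem ext_one_of_exists_lift {S : ShortComplex C} (hS : S.ShortExact) [Injective S.X₂]
    {M : C} (h : ∀ f : M ⟶ S.X₃, ∃ f' : M ⟶ S.X₂, f' ≫ S.g = f) :
    Subsingleton (Ext M S.X₁ 1) := by
  refine subsingleton_of_forall_eq 0 fun x => ?_
  obtain ⟨y, rfl⟩ := Ext.covariant_sequence_exact₁ M hS x (Ext.eq_zero_of_injective _)
    (zero_add 1)
  obtain ⟨f, rfl⟩ := Ext.addEquiv₀.symm.surjective y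
  obtain ⟨f', rfl⟩ := h f
  simp only [Ext.addEquiv₀_symm_apply]
  rw [← Ext.mk₀_comp_mk₀, Ext.comp_assoc (h₂₃ := zero_add 1) (h := rfl), hS.comp_extClass,
    Ext.comp_zero]

/-- In a Grothendieck abelian category the small object argument applies to every small family
of monomorphisms. -/
theorem hasSmallObjectArgument_ofHoms {D : Type u} [Category.{v} D] [Abelian D]
    [IsGrothendieckAbelian.{v} D] {ι : Type v} {A B : ι → D} (i : ∀ j, A j ⟶ B j)
    [∀ j, Mono (i j)] : HasSmallObjectArgument.{v} (ofHoms i) := by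
  obtain ⟨κ, hκ', hκ⟩ :=
    HasCardinalLT.exists_regular_cardinal_forall.{v} (fun j => Subobject (A j))
  have : Fact κ.IsRegular := ⟨hκ'⟩
  have : Nonempty κ.ord.ToType := by simpa using hκ'.ne_zero
  have := WellFoundedLT.toOrderBot κ.ord.ToType
  have hmono : ofHoms i ≤ monomorphisms D := by
    rintro X Y f ⟨j⟩
    exact monomorphisms.infer_property _
  exact ⟨κ, inferInstance, inferInstance,
    { preservesColimit {A B X Y} i hi f hf := by
        let hf' : (monomorphisms D).TransfiniteCompositionOfShape κ.ord.ToType f :=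
          { toTransfiniteCompositionOfShape := hf.toTransfiniteCompositionOfShape
            map_mem j hj := by
              have := (hf.attachCells j hj).pushouts_coproducts
              simp only [ofHoms_homFamily] at this
              refine (?_ : _ ≤ monomorphisms D) _ this
              simpa only [pushouts_le_iff, coproducts_le_iff] using hmono }
        have (j j' : κ.ord.ToType) (φ : j ⟶ j') : Mono (hf'.F.map φ) := hf'.mem_map φ
        apply IsGrothendieckAbelian.preservesColimit_coyoneda_obj_of_mono (Y := hf'.F) (κ := κ)
        obtain ⟨j⟩ := hi
        exact hκ j }⟩

section Preenvelope

variable {D : Type u} [Category.{v} D] [Abelian D] [HasExt.{w'} D]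

/-- If `Ext¹` vanishes between the cokernel of a monomorphism with projective target and the
kernel of an epimorphism, then the former has the left lifting property against the latter. -/
theorem hasLiftingProperty_of_ext_one {S T : ShortComplex D} (hS : S.ShortExact)
    (hT : T.ShortExact) [Projective S.X₂] (h : Subsingleton (Ext S.X₃ T.X₁ 1)) :
    HasLiftingProperty S.f T.g := by
  have := hT.epi_g
  have := hT.mono_f
  refine ⟨fun {a b} sq => ?_⟩
  have hd : (a - S.f ≫ Projective.factorThru b T.g) ≫ T.g = 0 := by
    simp [sq.w]
  obtain ⟨e, he⟩ := exists_extension_of_ext_one hS h (hT.exact.lift _ hd)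
  refine ⟨⟨⟨Projective.factorThru b T.g + e ≫ T.f, ?_, by simp⟩⟩⟩
  rw [Preadditive.comp_add, reassoc_of% he, hT.exact.lift_f]
  abel

/-- **The theorem of Eklof and Trlifaj** for a small family of objects, each given with a
projective presentation: every object embeds into an object right orthogonal to the family, with
a cokernel that is left orthogonal to everything right orthogonal to the family. The embedding is
obtained by the small object argument, and its properties are read off its lifting property. -/
theorem exists_rightOrthogonal_embedding [IsGrothendieckAbelian.{v} D] {ι : Type v}
    (S : ι → ShortComplex D) (hS : ∀ j, (S j).ShortExact) [∀ j, Projective (S j).X₂] (M : D) :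
    ∃ T : ShortComplex D, T.ShortExact ∧ T.X₁ = M ∧
      (∀ j, Subsingleton (Ext (S j).X₃ T.X₂ 1)) ∧
      ∀ N : D, (∀ j, Subsingleton (Ext (S j).X₃ N 1)) → Subsingleton (Ext T.X₃ N 1) := by
  have (j : ι) : Mono (S j).f := (hS j).mono_f
  have := hasSmallObjectArgument_ofHoms (fun j => (S j).f)
  set I := ofHoms (fun j => (S j).f) with hI
  have hIf (j : ι) : I (S j).f := ⟨j⟩
  let F := (functorialFactorizationData I.rlp.llp I.rlp).factorizationData (0 : M ⟶ 0)
  -- The map from the injective object containing `M` to `0` has the right lifting property against the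
  -- monomorphisms of the family, hence against `F.i`; so `M` embeds through `F.i`.
  have hmono : Mono F.i := by
    have : I.rlp (0 : Injective.under M ⟶ 0) := by
      rintro X Y f ⟨j⟩
      refine ⟨fun {a b} sq => ⟨⟨⟨Injective.factorThru a (S j).f, by simp, ?_⟩⟩⟩⟩
      exact (isZero_zero D).eq_of_tgt _ _
    have := F.hi _ this
    have sq : CommSq (Injective.ι M) F.i (0 : Injective.under M ⟶ 0) 0 :=
      ⟨(isZero_zero D).eq_of_tgt _ _⟩
    exact mono_of_mono_fac sq.fac_left
  refine ⟨ShortComplex.mk F.i (cokernel.π F.i) (cokernel.condition _),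
    { exact := ShortComplex.exact_cokernel _ }, rfl, fun j => ?_, fun N hN => ?_⟩
  · refine ext_one_of_exists_extension (hS j) fun f => ?_
    have := F.hp _ (hIf j)
    have sq : CommSq f (S j).f F.p 0 := ⟨(isZero_zero D).eq_of_tgt _ _⟩
    exact ⟨sq.lift, sq.fac_left⟩
  · -- For an embedding of `N` into an injective object, a map from the cokernel of `F.i` to the
    -- quotient lifts, because the quotient map has the right lifting property against `F.i`.
    let T : ShortComplex D :=
      ShortComplex.mk (Injective.ι N) (cokernel.π (Injective.ι N)) (cokernel.condition _)
    have hT : T.ShortExact := { exact := ShortComplex.exact_cokernel _ }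
    have : Injective T.X₂ := inferInstanceAs (Injective (Injective.under N))
    refine ext_one_of_exists_lift hT fun f => ?_
    have hp : I.rlp T.g := by
      rintro X Y f ⟨j⟩
      exact hasLiftingProperty_of_ext_one (hS j) hT (hN j)
    have := F.hi _ hp
    have sq : CommSq (0 : M ⟶ T.X₂) F.i T.g (cokernel.π F.i ≫ f) := ⟨by simp⟩
    refine ⟨cokernel.desc F.i sq.lift sq.fac_left, ?_⟩
    rw [← cancel_epi (cokernel.π F.i)]
    simp

/-- The counterpart of `exists_rightOrthogonal_embedding`: every object is the quotient of an
object that is left orthogonal to everything right orthogonal to the family, by a subobject right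
orthogonal to the family. -/
theorem exists_leftOrthogonal_cover [IsGrothendieckAbelian.{v} D] [EnoughProjectives D]
    {ι : Type v} (S : ι → ShortComplex D) (hS : ∀ j, (S j).ShortExact)
    [∀ j, Projective (S j).X₂] (M : D) :
    ∃ T : ShortComplex D, T.ShortExact ∧ T.X₃ = M ∧
      (∀ j, Subsingleton (Ext (S j).X₃ T.X₁ 1)) ∧
      ∀ N : D, (∀ j, Subsingleton (Ext (S j).X₃ N 1)) → Subsingleton (Ext T.X₂ N 1) := by
  -- A morphism `0 ⟶ P` with `P` projective over a separator is added to the family, so that the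
  -- right lifting property against the family forces a morphism to be an epimorphism.
  let P := Projective.over (separator D)
  let S' : Option ι → ShortComplex D :=
    fun o => o.elim (ShortComplex.mk (0 : 0 ⟶ P) (𝟙 P) (by simp)) S
  have hS' : ∀ o, (S' o).ShortExact := by
    rintro (_ | j)
    · exact { exact := (ShortComplex.exact_iff_mono _ rfl).2 (inferInstanceAs (Mono (𝟙 P)))
              mono_f := inferInstanceAs (Mono (0 : (0 : D) ⟶ P))
              epi_g := inferInstanceAs (Epi (𝟙 P)) }
    · exact hS j
  have hP' : ∀ o, Projective (S' o).X₂ := by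
    rintro (_ | j)
    · exact inferInstanceAs (Projective P)
    · exact inferInstanceAs (Projective (S j).X₂)
  have (o : Option ι) : Mono (S' o).f := (hS' o).mono_f
  have := hasSmallObjectArgument_ofHoms (fun o => (S' o).f)
  set I := ofHoms (fun o => (S' o).f) with hI
  let F := (functorialFactorizationData I.rlp.llp I.rlp).factorizationData (0 : 0 ⟶ M)
  have hp (o : Option ι) : HasLiftingProperty (S' o).f F.p := F.hp _ ⟨o⟩
  have hepi : Epi F.p := by
    refine ⟨fun a b hab => (isSeparator_separator D).def a b fun h => ?_⟩
    have := hp none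
    have sq : CommSq 0 (S' none).f F.p (Projective.π (separator D) ≫ h) :=
      ⟨(isZero_zero D).eq_of_src _ _⟩
    obtain ⟨l, hl⟩ : ∃ l : P ⟶ F.Z, l ≫ F.p = Projective.π (separator D) ≫ h :=
      ⟨sq.lift, sq.fac_right⟩
    rw [← cancel_epi (Projective.π (separator D)), ← Category.assoc, ← Category.assoc,
      ← hl, Category.assoc, Category.assoc, hab]
  refine ⟨ShortComplex.mk (kernel.ι F.p) F.p (kernel.condition _),
    { exact := ShortComplex.exact_kernel _ }, rfl, fun j => ?_, fun N hN => ?_⟩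
  · refine ext_one_of_exists_extension (hS j) fun f => ?_
    have : HasLiftingProperty (S j).f F.p := hp (some j)
    have sq : CommSq (f ≫ kernel.ι F.p) (S j).f F.p 0 := ⟨by simp⟩
    refine ⟨kernel.lift F.p sq.lift (by simp), ?_⟩
    rw [← cancel_mono (kernel.ι F.p)]
    simp
  · let T : ShortComplex D :=
      ShortComplex.mk (Injective.ι N) (cokernel.π (Injective.ι N)) (cokernel.condition _)
    have hT : T.ShortExact := { exact := ShortComplex.exact_cokernel _ }
    have : Injective T.X₂ := inferInstanceAs (Injective (Injective.under N))
    refine ext_one_of_exists_lift hT fun f => ?_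
    have hg : I.rlp T.g := by
      rintro X Y f ⟨o⟩
      refine hasLiftingProperty_of_ext_one (hS' o) hT ?_
      rcases o with _ | j
      · exact Ext.subsingleton_of_projective P _ 0
      · exact hN j
    have := F.hi _ hg
    have sq : CommSq 0 F.i T.g f := ⟨(isZero_zero D).eq_of_src _ _⟩
    exact ⟨sq.lift, sq.fac_right⟩

end Preenvelope

end Abelian

/-! ### Extension criteria for modules -/

section Modules

open Abelian

variable {R : Type u} [Ring R]

/-- An exact pair of linear maps as a short complex of modules. -/
abbrev shortComplexOfExact {A E C : Type v} [AddCommGroup A] [Module R A] [AddCommGroup E]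
    [Module R E] [AddCommGroup C] [Module R C] {i : A →ₗ[R] E} {p : E →ₗ[R] C}
    (hex : Function.Exact i p) : ShortComplex (ModuleCat.{v} R) :=
  ShortComplex.mk (ModuleCat.ofHom i) (ModuleCat.ofHom p)
    (by rw [← ModuleCat.ofHom_comp, hex.linearMap_comp_eq_zero, ModuleCat.ofHom_zero])

theorem shortExact_ofHom {A E C : Type v} [AddCommGroup A] [Module R A] [AddCommGroup E]
    [Module R E] [AddCommGroup C] [Module R C] {i : A →ₗ[R] E} {p : E →ₗ[R] C}
    (hi : Function.Injective i) (hex : Function.Exact i p) (hp : Function.Surjective p) :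
    (shortComplexOfExact hex).ShortExact where
  exact := (ShortComplex.ShortExact.moduleCat_exact_iff_function_exact _).2 hex
  mono_f := (ModuleCat.mono_iff_injective _).2 hi
  epi_g := (ModuleCat.epi_iff_surjective _).2 hp

variable [Small.{v} R]
  {A E C N : Type v} [AddCommGroup A] [Module R A] [AddCommGroup E] [Module R E]
  [AddCommGroup C] [Module R C] [AddCommGroup N] [Module R N]

/-- The vanishing of `Ext¹(C, N)` for unbundled modules. -/
abbrev ExtOneVanishes (R : Type u) [Ring R] [Small.{v} R] (C N : Type v) [AddCommGroup C]
    [Module R C] [AddCommGroup N] [Module R N] : Prop :=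
  Subsingleton (Ext (ModuleCat.of R C) (ModuleCat.of R N) 1)

theorem ExtOneVanishes.exists_extension (h : ExtOneVanishes R C N) {i : A →ₗ[R] E}
    {p : E →ₗ[R] C} (hi : Function.Injective i) (hex : Function.Exact i p)
    (hp : Function.Surjective p) (f : A →ₗ[R] N) : ∃ f' : E →ₗ[R] N, f' ∘ₗ i = f := by
  obtain ⟨f', hf'⟩ :=
    exists_extension_of_ext_one (shortExact_ofHom hi hex hp) h (ModuleCat.ofHom f)
  exact ⟨f'.hom, congrArg ModuleCat.Hom.hom hf'⟩

theorem ExtOneVanishes.exists_lift (h : ExtOneVanishes R N A) {i : A →ₗ[R] E}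
    {p : E →ₗ[R] C} (hi : Function.Injective i) (hex : Function.Exact i p)
    (hp : Function.Surjective p) (f : N →ₗ[R] C) : ∃ f' : N →ₗ[R] E, p ∘ₗ f' = f := by
  obtain ⟨f', hf'⟩ :=
    exists_lift_of_ext_one (shortExact_ofHom hi hex hp) h (ModuleCat.ofHom f)
  exact ⟨f'.hom, congrArg ModuleCat.Hom.hom hf'⟩

theorem extOneVanishes_of_exists_extension [Module.Projective R E] {i : A →ₗ[R] E}
    {p : E →ₗ[R] C} (hi : Function.Injective i) (hex : Function.Exact i p)
    (hp : Function.Surjective p) (h : ∀ f : A →ₗ[R] N, ∃ f' : E →ₗ[R] N, f' ∘ₗ i = f) :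
    ExtOneVanishes R C N := by
  have : Projective (ModuleCat.of R E) :=
    (IsProjective.iff_projective (R := R) E).1 inferInstance
  refine ext_one_of_exists_extension (shortExact_ofHom hi hex hp) fun f => ?_
  obtain ⟨f', hf'⟩ := h f.hom
  exact ⟨ModuleCat.ofHom f', ModuleCat.hom_ext hf'⟩

theorem extOneVanishes_of_projective [Module.Projective R C] : ExtOneVanishes R C N :=
  have : Projective (ModuleCat.of R C) :=
    (IsProjective.iff_projective (R := R) C).1 inferInstance
  Ext.subsingleton_of_projective _ _ 0

variable (R C) in
/-- Every module has a projective presentation in its own universe. -/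
theorem exists_projective_presentation : ∃ (P : Type v) (_ : AddCommGroup P) (_ : Module R P)
    (p : P →ₗ[R] C), Module.Projective R P ∧ Function.Surjective p := by
  let P := Projective.over (ModuleCat.of R C)
  refine ⟨P, inferInstance, inferInstance, (Projective.π (ModuleCat.of R C)).hom, ?_, ?_⟩
  · exact (IsProjective.iff_projective (R := R) P).2 (Projective.projective_over _)
  · exact (ModuleCat.epi_iff_surjective _).1 inferInstance

/-- A module `N` that is a retract of a module `A` inherits the vanishing of `Ext¹(C, -)`. -/
theorem ExtOneVanishes.of_retract (h : ExtOneVanishes R C A) (j : N →ₗ[R] A) (r : A →ₗ[R] N)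
    (hr : r ∘ₗ j = LinearMap.id) : ExtOneVanishes R C N := by
  obtain ⟨P, _, _, p, _, hp⟩ := exists_projective_presentation R C
  refine extOneVanishes_of_exists_extension (Submodule.injective_subtype _)
    (LinearMap.exact_subtype_ker_map p) hp fun f => ?_
  obtain ⟨f', hf'⟩ := h.exists_extension (Submodule.injective_subtype _)
    (LinearMap.exact_subtype_ker_map p) hp (j ∘ₗ f)
  exact ⟨r ∘ₗ f', by rw [LinearMap.comp_assoc, hf', ← LinearMap.comp_assoc, hr,
    LinearMap.id_comp]⟩

end Modules

/-! ### Diagonal tensor products and conjugation modules over a group ring -/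

noncomputable section Tensor

variable {k : Type u} [CommRing k] {G : Type v} [Group G]

variable {B : Type*} [AddCommGroup B] [Module k B] (β : Representation k G B)

variable {L M N : Type*} [AddCommGroup L] [Module k L] [Module k[G] L] [IsScalarTower k k[G] L]
  [AddCommGroup M] [Module k M] [Module k[G] M] [IsScalarTower k k[G] M]
  [AddCommGroup N] [Module k N] [Module k[G] N] [IsScalarTower k k[G] N]

theorem ofModule'_apply (g : G) (x : M) :
    Representation.ofModule' (k := k) M g x = single g (1 : k) • x :=
  rfl

theorem asModuleEquiv_single_smul {V : Type*} [AddCommMonoid V] [Module k V]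
    (ρ : Representation k G V) (g : G) (x : ρ.asModule) :
    ρ.asModuleEquiv (single g (1 : k) • x) = ρ g (ρ.asModuleEquiv x) := by
  rw [Representation.asModuleEquiv_map_smul, Representation.asAlgebraHom_single_one]

variable (M) in
/-- The diagonal module `M ⊗ B`, with the action `g · (m ⊗ b) = g m ⊗ g b`. The module `M` carries
a compatible `k`-module structure as an instance, so that the tensor product is that of `M` itself
and not of a type synonym of it. -/
def DiagTensor : Type _ :=
  ((Representation.ofModule' (k := k) (G := G) M).tprod β).asModule

namespace DiagTensor

instance : AddCommGroup (DiagTensor β M) :=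
  inferInstanceAs (AddCommGroup ((Representation.ofModule' (k := k) M).tprod β).asModule)

instance : Module k (DiagTensor β M) :=
  inferInstanceAs (Module k ((Representation.ofModule' (k := k) M).tprod β).asModule)

instance : Module k[G] (DiagTensor β M) :=
  inferInstanceAs (Module k[G] ((Representation.ofModule' (k := k) M).tprod β).asModule)

instance : IsScalarTower k k[G] (DiagTensor β M) :=
  inferInstanceAs (IsScalarTower k k[G] ((Representation.ofModule' (k := k) M).tprod β).asModule)

variable (M) in
/-- The identification of the diagonal module with the tensor product. -/
def equiv : DiagTensor β M ≃ₗ[k] M ⊗[k] B :=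
  ((Representation.ofModule' (k := k) M).tprod β).asModuleEquiv

theorem equiv_single_smul (g : G) (x : DiagTensor β M) :
    equiv β M (single g (1 : k) • x) =
      (Representation.ofModule' (k := k) M).tprod β g (equiv β M x) :=
  asModuleEquiv_single_smul ((Representation.ofModule' (k := k) M).tprod β) g x

/-- The pure tensor `m ⊗ b` as an element of the diagonal module. -/
def tmul (m : M) (b : B) : DiagTensor β M :=
  (equiv β M).symm (m ⊗ₜ[k] b)

variable {β}

@[elab_as_elim]
theorem induction {p : DiagTensor β M → Prop} (zero : p 0)
    (tmul : ∀ m b, p (tmul β m b)) (add : ∀ x y, p x → p y → p (x + y)) (x : DiagTensor β M) :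
    p x := by
  obtain ⟨y, rfl⟩ := (equiv β _).symm.surjective x
  induction y using TensorProduct.induction_on with
  | zero => simpa using zero
  | tmul m b => exact tmul m b
  | add x y hx hy => rw [map_add]; exact add _ _ hx hy

theorem single_smul_tmul (g : G) (m : M) (b : B) :
    single g (1 : k) • tmul β m b = tmul β (single g (1 : k) • m) (β g b) := by
  apply (equiv β _).injective
  rw [equiv_single_smul, tmul, LinearEquiv.apply_symm_apply,
    Representation.tprod_apply, TensorProduct.map_tmul, ofModule'_apply, tmul,
    LinearEquiv.apply_symm_apply]

variable (β) in
/-- The universal bilinear map `(m, b) ↦ m ⊗ b`. -/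
def mk : M →ₗ[k] B →ₗ[k] DiagTensor β M :=
  (TensorProduct.mk k M B).compr₂ (equiv β _).symm.toLinearMap

theorem mk_apply (m : M) (b : B) : mk β m b = tmul β m b := rfl

/-- An equivariant bilinear map out of `M × B` extends to the diagonal module. -/
def lift (f : M →ₗ[k] B →ₗ[k] N)
    (hf : ∀ g m b, f (single g (1 : k) • m) (β g b) = single g (1 : k) • f m b) :
    DiagTensor β M →ₗ[k[G]] N :=
  equivariantOfLinearOfComm
    (TensorProduct.lift f ∘ₗ (equiv β _).toLinearMap) fun g x => by
      induction x using induction with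
      | zero => simp only [smul_zero, map_zero]
      | tmul m b => rw [single_smul_tmul]; exact hf g m b
      | add x y hx hy => rw [smul_add, map_add, map_add, hx, hy, smul_add]

omit [Module k N] [IsScalarTower k k[G] N] in
theorem hom_ext {f g : DiagTensor β M →ₗ[k[G]] N}
    (h : ∀ m b, f (tmul β m b) = g (tmul β m b)) : f = g := by
  ext x
  induction x using induction with
  | zero => simp only [map_zero]
  | tmul m b => exact h m b
  | add x y hx hy => rw [map_add, map_add, hx, hy]

variable (β) in
/-- The map `f ⊗ B` between diagonal modules. -/
def map (f : M →ₗ[k[G]] N) : DiagTensor β M →ₗ[k[G]] DiagTensor β N :=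
  lift (mk β ∘ₗ f.restrictScalars k) fun g m b => by
    simp only [LinearMap.comp_apply, LinearMap.restrictScalars_apply, mk_apply, map_smul,
      single_smul_tmul]

theorem map_tmul (f : M →ₗ[k[G]] N) (m : M) (b : B) : map β f (tmul β m b) = tmul β (f m) b :=
  rfl

theorem equiv_map (f : M →ₗ[k[G]] N) (x : DiagTensor β M) :
    equiv β _ (map β f x) =
      (f.restrictScalars k).rTensor B (equiv β _ x) := by
  induction x using induction with
  | zero => simp only [map_zero]
  | tmul m b => rfl
  | add x y hx hy => simp only [map_add, hx, hy]

theorem map_injective [Module.Flat k B] {f : M →ₗ[k[G]] N} (hf : Function.Injective f) :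
    Function.Injective (map β f) := fun x y hxy =>
  (equiv β _).injective <|
    Module.Flat.rTensor_preserves_injective_linearMap (M := B) (f.restrictScalars k) hf <| by
      rw [← equiv_map, ← equiv_map, hxy]

theorem map_surjective {f : M →ₗ[k[G]] N} (hf : Function.Surjective f) :
    Function.Surjective (map β f) := fun y => by
  obtain ⟨x, hx⟩ := LinearMap.rTensor_surjective B (g := f.restrictScalars k) hf
    (equiv β _ y)
  refine ⟨(equiv β _).symm x, (equiv β _).injective ?_⟩
  rw [equiv_map, LinearEquiv.apply_symm_apply, hx]

theorem map_exact {f : L →ₗ[k[G]] M} {g : M →ₗ[k[G]] N} (hfg : Function.Exact f g)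
    (hg : Function.Surjective g) : Function.Exact (map β f) (map β g) := fun y => by
  have h := rTensor_exact B (f := f.restrictScalars k) (g := g.restrictScalars k) hfg hg
    (equiv β _ y)
  rw [← equiv_map, LinearEquiv.map_eq_zero_iff] at h
  refine h.trans ⟨?_, ?_⟩
  · rintro ⟨x, hx⟩
    refine ⟨(equiv β _).symm x,
      (equiv β _).injective ?_⟩
    rw [equiv_map, LinearEquiv.apply_symm_apply, hx]
  · rintro ⟨x, rfl⟩
    exact ⟨equiv β _ x, (equiv_map f x).symm⟩

end DiagTensor

variable (N) in
/-- The module `Hom(B, N)` with the conjugation action `(g · φ)(b) = g φ(g⁻¹ b)`. -/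
def ConjHom : Type _ :=
  (β.linHom (Representation.ofModule' (k := k) (G := G) N)).asModule

namespace ConjHom

instance : AddCommGroup (ConjHom β N) :=
  inferInstanceAs (AddCommGroup (β.linHom (Representation.ofModule' (k := k) N)).asModule)

instance : Module k (ConjHom β N) :=
  inferInstanceAs (Module k (β.linHom (Representation.ofModule' (k := k) N)).asModule)

instance : Module k[G] (ConjHom β N) :=
  inferInstanceAs (Module k[G] (β.linHom (Representation.ofModule' (k := k) N)).asModule)

instance : IsScalarTower k k[G] (ConjHom β N) :=
  inferInstanceAs (IsScalarTower k k[G] (β.linHom (Representation.ofModule' (k := k) N)).asModule)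

variable (N) in
/-- The identification of the conjugation module with the module of linear maps. -/
def equiv : ConjHom β N ≃ₗ[k] (B →ₗ[k] N) :=
  (β.linHom (Representation.ofModule' (k := k) N)).asModuleEquiv

variable {β}

/-- The evaluation of `φ : Hom(B, N)` at `b`. -/
def eval : ConjHom β N →ₗ[k] B →ₗ[k] N := (equiv β _).toLinearMap

theorem ext {φ ψ : ConjHom β N} (h : ∀ b, eval φ b = eval ψ b) : φ = ψ :=
  (equiv β _).injective (LinearMap.ext h)

theorem eval_single_smul (g : G) (φ : ConjHom β N) (b : B) :
    eval (single g (1 : k) • φ) b = single g (1 : k) • eval φ (β g⁻¹ b) := by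
  have h := asModuleEquiv_single_smul (β.linHom (Representation.ofModule' N)) g φ
  exact LinearMap.congr_fun h b

variable (β) in
/-- A linear map `B → N` as an element of the conjugation module. -/
def ofLinearMap : (B →ₗ[k] N) →ₗ[k] ConjHom β N :=
  (equiv β _).symm.toLinearMap

theorem eval_ofLinearMap (f : B →ₗ[k] N) (b : B) : eval (ofLinearMap β f) b = f b := rfl

/-- An equivariant bilinear map on `M × B` induces a map from `M` to the conjugation module. -/
def lift (f : M →ₗ[k] B →ₗ[k] N)
    (hf : ∀ g m b, f (single g (1 : k) • m) (β g b) = single g (1 : k) • f m b) :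
    M →ₗ[k[G]] ConjHom β N :=
  equivariantOfLinearOfComm (ofLinearMap β ∘ₗ f) fun g m => by
    refine ext fun b => ?_
    rw [eval_single_smul, LinearMap.comp_apply, LinearMap.comp_apply, eval_ofLinearMap,
      eval_ofLinearMap, ← hf, Representation.self_inv_apply]

/-- Transposition `Hom(M ⊗ B, N) → Hom(M, Hom(B, N))`. -/
def curry (f : DiagTensor β M →ₗ[k[G]] N) : M →ₗ[k[G]] ConjHom β N :=
  lift ((DiagTensor.mk β).compr₂ (f.restrictScalars k)) fun g m b => by
    simp only [LinearMap.compr₂_apply, LinearMap.restrictScalars_apply, DiagTensor.mk_apply,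
      ← DiagTensor.single_smul_tmul, map_smul]

theorem eval_curry (f : DiagTensor β M →ₗ[k[G]] N) (m : M) (b : B) :
    eval (curry f m) b = f (DiagTensor.tmul β m b) :=
  rfl

/-- Transposition `Hom(M, Hom(B, N)) → Hom(M ⊗ B, N)`. -/
def uncurry (f : M →ₗ[k[G]] ConjHom β N) : DiagTensor β M →ₗ[k[G]] N :=
  DiagTensor.lift (eval ∘ₗ f.restrictScalars k) fun g m b => by
    simp only [LinearMap.comp_apply, LinearMap.restrictScalars_apply, map_smul,
      eval_single_smul, Representation.inv_self_apply]

variable (β) in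
/-- Postcomposition with a linear map. -/
def map (f : M →ₗ[k[G]] N) : ConjHom β M →ₗ[k[G]] ConjHom β N :=
  lift (eval.compr₂ (f.restrictScalars k)) fun g φ b => by
    simp only [LinearMap.compr₂_apply, LinearMap.restrictScalars_apply, eval_single_smul,
      Representation.inv_self_apply, map_smul]

theorem eval_map (f : M →ₗ[k[G]] N) (φ : ConjHom β M) (b : B) :
    eval (map β f φ) b = f (eval φ b) :=
  rfl

theorem map_injective {f : M →ₗ[k[G]] N} (hf : Function.Injective f) :
    Function.Injective (map β f) := fun φ ψ h =>
  ext fun b => hf (by rw [← eval_map, h, eval_map])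

theorem map_surjective [Module.Projective k B] {f : M →ₗ[k[G]] N}
    (hf : Function.Surjective f) : Function.Surjective (map β f) := fun φ => by
  obtain ⟨ψ, hψ⟩ := Module.projective_lifting_property (f.restrictScalars k) (eval φ) hf
  exact ⟨ofLinearMap β ψ, ext fun b => LinearMap.congr_fun hψ b⟩

theorem map_exact {f : L →ₗ[k[G]] M} {g : M →ₗ[k[G]] N} (hf : Function.Injective f)
    (hfg : Function.Exact f g) : Function.Exact (map β f) (map β g) := fun φ => by
  constructor
  · intro h
    have hφ (b : B) : ∃ x, f x = eval φ b :=
      (hfg _).1 (by rw [← eval_map, h, map_zero, LinearMap.zero_apply])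
    choose ψ hψ using hφ
    refine ⟨ofLinearMap β ⟨⟨ψ, fun b b' => hf ?_⟩, fun c b => hf ?_⟩, ext fun b => hψ b⟩
    · rw [map_add, hψ, hψ, hψ, map_add]
    · rw [hψ, RingHom.id_apply, map_smul, LinearMap.map_smul_of_tower, hψ]
  · rintro ⟨ψ, rfl⟩
    refine ext fun b => ?_
    rw [eval_map, eval_map, hfg.apply_apply_eq_zero, map_zero, LinearMap.zero_apply]

end ConjHom

end Tensor

/-! ### Cofibrant modules relative to a free diagonal coefficient module -/

noncomputable section Relative

variable {k : Type u} [CommRing k] {G : Type v} [Group G]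

/-- A `k[G]`-module becomes a `k`-module by restriction of scalars. This supplies the compatible
`k`-structure that diagonal and conjugation modules require. -/
theorem isScalarTower_compHom (M : Type*) [AddCommGroup M] [Module k[G] M] :
    letI := Module.compHom M (algebraMap k k[G])
    IsScalarTower k k[G] M :=
  letI := Module.compHom M (algebraMap k k[G])
  ⟨fun c r x => by rw [Algebra.smul_def, mul_smul]; rfl⟩

variable [Small.{w} k[G]] {B : Type w} [AddCommGroup B] [Module k B] {β : Representation k G B}
variable {M : Type w} [AddCommGroup M] [Module k M] [Module k[G] M] [IsScalarTower k k[G] M]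
  {N : Type w} [AddCommGroup N] [Module k N] [Module k[G] N] [IsScalarTower k k[G] N]

variable (M N) in
/-- The adjunction isomorphism `Ext¹(M, Hom(B, N)) ≅ Ext¹(M ⊗ B, N) = 0` for `M ⊗ B`
projective, in terms of extensions of maps from a syzygy. -/
theorem extOneVanishes_conjHom [Module.Flat k B] [Module.Projective k[G] (DiagTensor β M)] :
    ExtOneVanishes k[G] M (ConjHom β N) := by
  obtain ⟨P, _, _, p, _, hp⟩ := exists_projective_presentation k[G] M
  let := Module.compHom P (algebraMap k k[G])
  have := isScalarTower_compHom (k := k) (G := G) P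
  refine extOneVanishes_of_exists_extension (Submodule.injective_subtype _)
    (LinearMap.exact_subtype_ker_map p) hp fun f => ?_
  have h : ExtOneVanishes k[G] (DiagTensor β M) N := extOneVanishes_of_projective
  obtain ⟨f', hf'⟩ := h.exists_extension
    (DiagTensor.map_injective (β := β) (Submodule.injective_subtype (LinearMap.ker p)))
    (DiagTensor.map_exact (LinearMap.exact_subtype_ker_map p) hp) (DiagTensor.map_surjective hp)
    (ConjHom.uncurry f)
  refine ⟨ConjHom.curry f', LinearMap.ext fun x => ConjHom.ext fun b => ?_⟩
  exact LinearMap.congr_fun hf' (DiagTensor.tmul β x b)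

/-- The converse of `extOneVanishes_conjHom`; as `Hom(B, -)` is exact, maps out of `M ⊗ B` lift
along epimorphisms. -/
theorem projective_diagTensor_of_extOneVanishes [Module.Projective k B]
    (h : ∀ (N : Type w) [AddCommGroup N] [Module k N] [Module k[G] N] [IsScalarTower k k[G] N],
      ExtOneVanishes k[G] M (ConjHom β N)) : Module.Projective k[G] (DiagTensor β M) := by
  have hlift {E X : Type w} [AddCommGroup E] [Module k[G] E] [AddCommGroup X] [Module k[G] X]
      (p : E →ₗ[k[G]] X) (hp : Function.Surjective p) (f : DiagTensor β M →ₗ[k[G]] X) :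
      ∃ f' : DiagTensor β M →ₗ[k[G]] E, p ∘ₗ f' = f := by
    let := Module.compHom E (algebraMap k k[G])
    have := isScalarTower_compHom (k := k) (G := G) E
    let := Module.compHom X (algebraMap k k[G])
    have := isScalarTower_compHom (k := k) (G := G) X
    obtain ⟨f', hf'⟩ := (h (LinearMap.ker p)).exists_lift
      (ConjHom.map_injective (β := β) (Submodule.injective_subtype _))
      (ConjHom.map_exact (Submodule.injective_subtype _) (LinearMap.exact_subtype_ker_map p))
      (ConjHom.map_surjective hp) (ConjHom.curry f)
    refine ⟨ConjHom.uncurry f', DiagTensor.hom_ext fun m b => ?_⟩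
    exact congrArg (fun φ => ConjHom.eval φ b) (LinearMap.congr_fun hf' m)
  obtain ⟨P, _, _, p, _, hp⟩ := exists_projective_presentation k[G] (DiagTensor β M)
  obtain ⟨s, hs⟩ := hlift p hp LinearMap.id
  exact Module.Projective.of_split s p hs

theorem projective_diagTensor_of_projective [Module.Projective k B] [Module.Projective k[G] M] :
    Module.Projective k[G] (DiagTensor β M) :=
  projective_diagTensor_of_extOneVanishes fun _ => extOneVanishes_of_projective

theorem projective_of_exact {R A E C : Type*} [Ring R] [AddCommGroup A] [Module R A]
    [AddCommGroup E] [Module R E] [AddCommGroup C] [Module R C] [Module.Projective R E]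
    [Module.Projective R C] {i : A →ₗ[R] E} {p : E →ₗ[R] C} (hi : Function.Injective i)
    (hex : Function.Exact i p) (hp : Function.Surjective p) : Module.Projective R A := by
  obtain ⟨s, hs⟩ := Module.projective_lifting_property p LinearMap.id hp
  obtain ⟨r, hr⟩ := ((hex.split_tfae hi hp).out 0 1 :).1 ⟨s, hs⟩
  exact Module.Projective.of_split i r hr

omit [Small.{w} k[G]] in
theorem projective_diagTensor_of_exact [Module.Flat k B] {A E C : Type*} [AddCommGroup A]
    [Module k A] [Module k[G] A] [IsScalarTower k k[G] A] [AddCommGroup E] [Module k E]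
    [Module k[G] E] [IsScalarTower k k[G] E] [AddCommGroup C] [Module k C] [Module k[G] C]
    [IsScalarTower k k[G] C] [Module.Projective k[G] (DiagTensor β E)]
    [Module.Projective k[G] (DiagTensor β C)] {i : A →ₗ[k[G]] E} {p : E →ₗ[k[G]] C}
    (hi : Function.Injective i) (hex : Function.Exact i p) (hp : Function.Surjective p) :
    Module.Projective k[G] (DiagTensor β A) :=
  projective_of_exact (DiagTensor.map_injective hi) (DiagTensor.map_exact hex hp)
    (DiagTensor.map_surjective hp)

/-- A projective module `P` is a retract of `Hom(B, P)`, through evaluation at an invariant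
element of `B` on which some linear functional takes the value `1`. -/
theorem extOneVanishes_of_projective_right [Module.Flat k B] {e : B} (he : ∀ g, β g e = e)
    {ε : B →ₗ[k] k} (hε : ε e = 1) [Module.Projective k[G] (DiagTensor β M)]
    [Module.Projective k[G] N] : ExtOneVanishes k[G] M N := by
  let ev : ConjHom β N →ₗ[k[G]] N :=
    equivariantOfLinearOfComm (ConjHom.eval.flip e) fun g φ => by
      simp only [LinearMap.flip_apply, ConjHom.eval_single_smul, he]
  have hev : Function.Surjective ev := fun n =>
    ⟨ConjHom.ofLinearMap β (ε.smulRight n), by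
      change ε e • n = n
      rw [hε, one_smul]⟩
  obtain ⟨s, hs⟩ := Module.projective_lifting_property ev LinearMap.id hev
  exact (extOneVanishes_conjHom M N).of_retract s ev hs

/-- If `B` is a ring with an action by ring automorphisms, given by a multiplication `μ` and a unit
`e`, then a cofibrant module `M` that is right orthogonal to all cofibrant modules is
projective, because the embedding of `M` into `M ⊗ B` splits. -/
theorem projective_of_extOneVanishes_cofibrant [Module.Projective k B] {e : B}
    (he : ∀ g, β g e = e) {ε : B →ₗ[k] k} (hε : ε e = 1) {μ : B →ₗ[k] B →ₗ[k] B}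
    (hμ : ∀ g b b', μ (β g b) (β g b') = β g (μ b b')) (hμe : ∀ b, μ e b = b)
    [Module.Projective k[G] (DiagTensor β M)]
    (h : ∀ (C : Type w) [AddCommGroup C] [Module k C] [Module k[G] C] [IsScalarTower k k[G] C],
      Module.Projective k[G] (DiagTensor β C) → ExtOneVanishes k[G] C M) :
    Module.Projective k[G] M := by
  let i : M →ₗ[k[G]] DiagTensor β M :=
    equivariantOfLinearOfComm ((DiagTensor.mk β).flip e) fun g m => by
      simp only [LinearMap.flip_apply, DiagTensor.mk_apply, DiagTensor.single_smul_tmul, he]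
  have hi : Function.Injective i := by
    -- The retraction `m ⊗ b ↦ ε(b) m` is `k`-linear, but not equivariant in general.
    let r : DiagTensor β M →ₗ[k] M :=
      TensorProduct.lift (LinearMap.lsmul k M ∘ₗ ε).flip ∘ₗ
        (DiagTensor.equiv β M).toLinearMap
    have hr (m : M) : r (i m) = m := by
      change ε e • m = m
      rw [hε, one_smul]
    exact Function.LeftInverse.injective hr
  let p := (LinearMap.range i).mkQ
  have hex : Function.Exact i p := LinearMap.exact_map_mkQ_range i
  have hp : Function.Surjective p := Submodule.mkQ_surjective _
  have hC : Module.Projective k[G] (DiagTensor β (DiagTensor β M ⧸ LinearMap.range i)) := by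
    refine projective_diagTensor_of_extOneVanishes fun N => ?_
    refine extOneVanishes_of_exists_extension hi hex hp fun f => ?_
    -- The extension sends `m ⊗ b` to `b' ↦ f(m)(b b')`.
    let F : M →ₗ[k] B →ₗ[k] ConjHom β N :=
      LinearMap.compr₂ ((LinearMap.llcomp k B B N ∘ₗ ConjHom.eval ∘ₗ f.restrictScalars k).compl₂ μ)
        (ConjHom.ofLinearMap β)
    have hF (m b b') : ConjHom.eval (F m b) b' = ConjHom.eval (f m) (μ b b') := rfl
    refine ⟨DiagTensor.lift F fun g m b => ConjHom.ext fun b' => ?_,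
      LinearMap.ext fun m => ConjHom.ext fun b => ?_⟩
    · rw [hF, map_smul, ConjHom.eval_single_smul, ConjHom.eval_single_smul, hF,
        ← hμ, Representation.inv_self_apply]
    · change ConjHom.eval (f m) (μ e b) = _
      rw [hμe]
  obtain ⟨r, hr⟩ := (h _ hC).exists_extension hi hex hp LinearMap.id
  exact Module.Projective.of_split i r hr

end Relative

/-! ### Eklof's lemma -/

section Eklof

variable {R : Type u} [Ring R] [Small.{v} R] {M N : Type v} [AddCommGroup M] [Module R M]
  [AddCommGroup N] [Module R N]

/-- **Eklof's lemma**, for a family of submodules closed under suprema in place of a continuous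
filtration: if every proper submodule of the family is contained in a strictly larger one with
quotient left orthogonal to `N`, then `M` is left orthogonal to `N`. A map from a syzygy of `M`
to `N` is extended step by step with the help of Zorn's lemma. -/
theorem extOneVanishes_of_submodules (nice : Submodule R M → Prop)
    (hsup : ∀ c : Set (Submodule R M), (∀ p ∈ c, nice p) → nice (sSup c))
    (hext : ∀ p, nice p → p ≠ ⊤ →
      ∃ q, nice q ∧ p < q ∧ ExtOneVanishes R (q.map p.mkQ) N) : ExtOneVanishes R M N := by
  obtain ⟨P, _, _, π, _, hπ⟩ := exists_projective_presentation R M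
  refine extOneVanishes_of_exists_extension (Submodule.injective_subtype _)
    (LinearMap.exact_subtype_ker_map π) hπ fun f => ?_
  -- The extensions of `f` whose domain has its image in `M` among the nice submodules.
  let f₀ : P →ₗ.[R] N := ⟨LinearMap.ker π, f⟩
  let S : Set (P →ₗ.[R] N) := {h | f₀ ≤ h ∧ nice (h.domain.map π)}
  have hf₀ : f₀ ∈ S := by
    refine ⟨le_rfl, ?_⟩
    have : (LinearMap.ker π).map π = sSup ∅ := by
      rw [sSup_empty, eq_bot_iff, Submodule.map_le_iff_le_comap]
      exact le_rfl
    exact this ▸ hsup ∅ (by simp)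
  obtain ⟨h, -, hmax⟩ := zorn_le_nonempty₀ S (fun c hcS hc y hy => by
    refine ⟨LinearPMap.sSup c hc.directedOn, ⟨?_, ?_⟩, fun z hz => LinearPMap.le_sSup _ hz⟩
    · exact (hcS hy).1.trans (LinearPMap.le_sSup _ hy)
    · rw [LinearPMap.domain_sSup, sSup_image, Submodule.map_iSup]
      simp_rw [Submodule.map_iSup]
      rw [← sSup_image]
      refine hsup _ ?_
      rintro _ ⟨z, hz, rfl⟩
      exact (hcS hz).2) f₀ hf₀
  have hker : LinearMap.ker π ≤ h.domain := hmax.prop.1.1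
  have hcomap : (h.domain.map π).comap π = h.domain := Submodule.comap_map_eq_self hker
  have htop : h.domain = ⊤ := by
    by_contra hne
    obtain ⟨q, hq, hlt, hv⟩ := hext _ hmax.prop.2 fun htop => hne <| by
      rw [← hcomap, htop, Submodule.comap_top]
    have hle : h.domain ≤ q.comap π := Submodule.map_le_iff_le_comap.1 hlt.le
    let p : q.comap π →ₗ[R] q.map (h.domain.map π).mkQ :=
      ((h.domain.map π).mkQ ∘ₗ π ∘ₗ (q.comap π).subtype).codRestrict _
        fun x => Submodule.mem_map_of_mem x.2
    have hp : Function.Surjective p := by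
      rintro ⟨_, x, hx, rfl⟩
      obtain ⟨y, rfl⟩ := hπ x
      exact ⟨⟨y, hx⟩, rfl⟩
    have hex : Function.Exact (Submodule.inclusion hle) p := fun x => by
      rw [← Subtype.val_inj]
      change (h.domain.map π).mkQ (π x) = 0 ↔ _
      rw [Submodule.mkQ_apply, Submodule.Quotient.mk_eq_zero, ← Submodule.mem_comap, hcomap]
      exact ⟨fun hx => ⟨⟨x, hx⟩, rfl⟩, by rintro ⟨y, rfl⟩; exact y.2⟩
    obtain ⟨f', hf'⟩ := hv.exists_extension (Submodule.inclusion_injective hle) hex hp h.toFun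
    let h' : P →ₗ.[R] N := ⟨q.comap π, f'⟩
    have hhh' : h ≤ h' := ⟨hle, fun x y hxy => by
      have : y = Submodule.inclusion hle x := Subtype.ext hxy.symm
      rw [this]
      exact (LinearMap.congr_fun hf' x).symm⟩
    have hh' : h' ∈ S := ⟨hmax.prop.1.trans hhh', by
      change nice ((q.comap π).map π)
      rwa [Submodule.map_comap_eq_of_surjective hπ]⟩
    have := Submodule.map_mono (f := π) (hmax.le_of_ge hh' hhh').1
    change (q.comap π).map π ≤ _ at this
    rw [Submodule.map_comap_eq_of_surjective hπ] at this
    exact hlt.not_ge this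
  refine ⟨h.toFun ∘ₗ (LinearMap.id.codRestrict h.domain fun x => htop ▸ Submodule.mem_top), ?_⟩
  ext x
  exact (hmax.prop.1.2 rfl).symm

end Eklof

/-! ### Small cofibrant subquotients -/

section SupportClosed

variable {R Q C : Type*} [Ring R] [AddCommGroup Q] [Module R Q] [AddCommGroup C] [Module R C]

/-- Let `s` be a section of the canonical map from the free module on `Q` onto `Q`. A submodule
that contains the supports of the values of `s` on it has a projective quotient. -/
theorem projective_of_support_closed {s : Q →ₗ[R] Q →₀ R}
    (hs : Function.LeftInverse (Finsupp.linearCombination R id) s) {p : Q →ₗ[R] C}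
    (hp : Function.Surjective p)
    (h : LinearMap.ker p ≤ (Finsupp.supported R R (LinearMap.ker p : Set Q)).comap s) :
    Module.Projective R C := by
  classical
  -- Erasing the coordinates in the kernel of `p` makes `s` vanish on that kernel, so that it
  -- descends to a section of the map from the free module on `Q` onto `C`.
  let r : (Q →₀ R) →ₗ[R] Q →₀ R :=
    (Finsupp.supported R R (LinearMap.ker p : Set Q)ᶜ).subtype ∘ₗ Finsupp.restrictDom R R _
  have hr_apply (f : Q →₀ R) : r f = f.filter (· ∈ (LinearMap.ker p : Set Q)ᶜ) :=
    rfl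
  have hr : Finsupp.linearCombination R p ∘ₗ r = Finsupp.linearCombination R p := by
    refine Finsupp.lhom_ext fun y a => ?_
    rw [LinearMap.comp_apply, hr_apply]
    by_cases hy : y ∈ (LinearMap.ker p : Set Q)ᶜ
    · rw [Finsupp.filter_single_of_pos _ hy]
    · have hy' : p y = 0 := by simpa using hy
      rw [Finsupp.filter_single_of_neg _ hy, map_zero, Finsupp.linearCombination_single, hy',
        smul_zero]
  have hr0 : LinearMap.ker p ≤ LinearMap.ker (r ∘ₗ s) := fun x hx => by
    rw [LinearMap.mem_ker, LinearMap.comp_apply, hr_apply, Finsupp.filter_eq_zero_iff]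
    intro y hy
    exact Finsupp.notMem_support_iff.1 fun hy' => hy (h hx hy')
  let e := p.quotKerEquivOfSurjective hp
  refine Module.Projective.of_split ((LinearMap.ker p).liftQ (r ∘ₗ s) hr0 ∘ₗ e.symm.toLinearMap)
    (Finsupp.linearCombination R p) ?_
  ext x
  obtain ⟨y, rfl⟩ := hp x
  have he : e.symm (p y) = (LinearMap.ker p).mkQ y := by
    rw [LinearEquiv.symm_apply_eq]
    rfl
  have hcomp : Finsupp.linearCombination R p = p ∘ₗ Finsupp.linearCombination R id := by
    ext y
    simp
  calc Finsupp.linearCombination R p ((LinearMap.ker p).liftQ (r ∘ₗ s) hr0 (e.symm (p y)))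
      = (Finsupp.linearCombination R p ∘ₗ r) (s y) := by
        rw [he, Submodule.mkQ_apply, Submodule.liftQ_apply]
        rfl
    _ = p y := by rw [hr, hcomp, LinearMap.comp_apply, hs y]

end SupportClosed

noncomputable section Deconstruction

variable {k : Type u} [CommRing k] {G : Type v} [Group G] {B : Type w} [AddCommGroup B]
  [Module k B] (β : Representation k G B)
  {M : Type w} [AddCommGroup M] [Module k M] [Module k[G] M] [IsScalarTower k k[G] M]

namespace DiagTensor

/-- The image of `M' ⊗ B` in `M ⊗ B` for a submodule `M'` of `M`, as a kernel. -/
def ofSubmodule (M' : Submodule k[G] M) : Submodule k[G] (DiagTensor β M) :=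
  LinearMap.ker (map β M'.mkQ)

variable {β}

/-- The submodule of all `m` with `m ⊗ b ∈ L` for all `b`. -/
def fiber (L : Submodule k[G] (DiagTensor β M)) : Submodule k[G] M :=
  LinearMap.ker (ConjHom.curry L.mkQ)

theorem mem_fiber {L : Submodule k[G] (DiagTensor β M)} {m : M} :
    m ∈ fiber L ↔ ∀ b, tmul β m b ∈ L := by
  simp_rw [← Submodule.Quotient.mk_eq_zero L]
  exact ⟨fun h b => by
    rw [← L.mkQ_apply, ← ConjHom.eval_curry, LinearMap.mem_ker.1 h, map_zero,
      LinearMap.zero_apply],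
    fun h => ConjHom.ext fun b => by
      rw [ConjHom.eval_curry, L.mkQ_apply, h, map_zero, LinearMap.zero_apply]⟩

variable (β) in
theorem ofSubmodule_gc : GaloisConnection (ofSubmodule β (M := M)) fiber := fun M' L => by
  constructor
  · intro h m hm
    refine mem_fiber.2 fun b => h ?_
    rw [ofSubmodule, LinearMap.mem_ker, map_tmul, M'.mkQ_apply,
      (Submodule.Quotient.mk_eq_zero M').2 hm, ← mk_apply, map_zero, LinearMap.zero_apply]
  · intro h x hx
    obtain ⟨y, rfl⟩ := (map_exact (β := β) (LinearMap.exact_subtype_mkQ M')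
      (Submodule.mkQ_surjective M') x).1 hx
    clear hx
    induction y using induction with
    | zero => rw [map_zero]; exact L.zero_mem
    | tmul m b => exact mem_fiber.1 (h m.2) b
    | add x y hx hy => rw [map_add]; exact L.add_mem hx hy

theorem tmul_mem_ofSubmodule {M' : Submodule k[G] M} {m : M} (hm : m ∈ M') (b : B) :
    tmul β m b ∈ ofSubmodule β M' :=
  mem_fiber.1 ((ofSubmodule_gc β).le_u_l M' hm) b

theorem ofSubmodule_mono : Monotone (ofSubmodule β (M := M)) := (ofSubmodule_gc β).monotone_l

theorem exists_finite_mem_ofSubmodule_span (x : DiagTensor β M) :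
    ∃ C : Set M, C.Finite ∧ x ∈ ofSubmodule β (Submodule.span k[G] C) := by
  induction x using induction with
  | zero => exact ⟨∅, Set.finite_empty, Submodule.zero_mem _⟩
  | tmul m b =>
    exact ⟨{m}, Set.finite_singleton m,
      tmul_mem_ofSubmodule (Submodule.subset_span (Set.mem_singleton m)) b⟩
  | add x y hx hy =>
    obtain ⟨C, hC, hx⟩ := hx
    obtain ⟨D, hD, hy⟩ := hy
    exact ⟨C ∪ D, hC.union hD, Submodule.add_mem _
      (ofSubmodule_mono (Submodule.span_mono Set.subset_union_left) hx)
      (ofSubmodule_mono (Submodule.span_mono Set.subset_union_right) hy)⟩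

/-- A sequence of elements of `M` suffices to generate a submodule whose diagonal module contains a
given finite set. -/
theorem exists_sequence_support_mem (f : DiagTensor β M →₀ k[G]) :
    ∃ c : ℕ → M, ∀ y ∈ f.support, y ∈ ofSubmodule β (Submodule.span k[G] (Set.range c)) := by
  choose C hC hmem using exists_finite_mem_ofSubmodule_span (β := β) (M := M)
  have hfin : (insert 0 (⋃ y ∈ f.support, C y)).Finite :=
    (f.support.finite_toSet.biUnion fun y _ => hC y).insert 0
  obtain ⟨c, hc⟩ := hfin.countable.exists_eq_range (Set.insert_nonempty _ _)
  refine ⟨c, fun y hy => ofSubmodule_mono (Submodule.span_mono ?_) (hmem y)⟩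
  rw [← hc]
  exact (Set.subset_biUnion_of_mem (u := C) hy).trans (Set.subset_insert _ _)

/-- A submodule `M'` of `M` is support closed with respect to a section `s` of the canonical map
from the free module on `M ⊗ B` to `M ⊗ B` if the image of `M' ⊗ B` contains the supports of
the values of `s` on it. -/
def SupportClosed (s : DiagTensor β M →ₗ[k[G]] DiagTensor β M →₀ k[G])
    (M' : Submodule k[G] M) : Prop :=
  ofSubmodule β M' ≤
    (Finsupp.supported k[G] k[G] (ofSubmodule β M' : Set (DiagTensor β M))).comap s

variable {s : DiagTensor β M →ₗ[k[G]] DiagTensor β M →₀ k[G]}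

theorem SupportClosed.sSup {c : Set (Submodule k[G] M)} (hc : ∀ p ∈ c, SupportClosed s p) :
    SupportClosed s (sSup c) := by
  refine (ofSubmodule_gc β _ _).2 (sSup_le fun p hp => (ofSubmodule_gc β _ _).1 ?_)
  exact (hc p hp).trans (Submodule.comap_mono (Finsupp.supported_mono
    (ofSubmodule_mono (le_sSup hp))))

theorem SupportClosed.projective_quotient
    (hs : Function.LeftInverse (Finsupp.linearCombination k[G] id) s) {M' : Submodule k[G] M}
    (h : SupportClosed s M') : Module.Projective k[G] (DiagTensor β (M ⧸ M')) :=
  projective_of_support_closed hs (map_surjective M'.mkQ_surjective) h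

/-- Every element of `M` lies in a support closed submodule that is generated by a family whose
index type depends on `B` only. -/
theorem exists_supportClosed (s : DiagTensor β M →ₗ[k[G]] DiagTensor β M →₀ k[G]) (x : M) :
    ∃ c : List (B × ℕ) → M, x ∈ Set.range c ∧
      SupportClosed s (Submodule.span k[G] (Set.range c)) := by
  choose e he using fun (m : M) (b : B) => exists_sequence_support_mem (s (tmul β m b))
  -- The least family that contains `x` and, with `m`, all elements of the sequences chosen for the
  -- tensors `m ⊗ b`; a list records the choices of `b` and of the index in the sequence.
  let c : List (B × ℕ) → M := List.foldr (fun i m => e m i.1 i.2) x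
  refine ⟨c, ⟨[], rfl⟩, (ofSubmodule_gc β _ _).2 (Submodule.span_le.2 ?_)⟩
  rintro _ ⟨l, rfl⟩
  refine mem_fiber.2 fun b y hy => ofSubmodule_mono (Submodule.span_mono ?_) (he (c l) b y hy)
  rintro _ ⟨n, rfl⟩
  exact ⟨(b, n) :: l, rfl⟩

end DiagTensor

theorem projective_diagTensor_of_equiv {M' : Type*} [AddCommGroup M'] [Module k M']
    [Module k[G] M'] [IsScalarTower k k[G] M'] (e : M ≃ₗ[k[G]] M')
    [Module.Projective k[G] (DiagTensor β M)] : Module.Projective k[G] (DiagTensor β M') :=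
  Module.Projective.of_split (DiagTensor.map β e.symm.toLinearMap)
    (DiagTensor.map β e.toLinearMap) (DiagTensor.hom_ext fun m b => by
      rw [LinearMap.comp_apply, DiagTensor.map_tmul, DiagTensor.map_tmul]
      simp)

end Deconstruction

section Small

variable {k : Type u} [CommRing k] {G : Type v} [Group G] {B : Type max u v} [AddCommGroup B]
  [Module k B] {β : Representation k G B} [Module.Flat k B]
  {M : Type max u v} [AddCommGroup M] [Module k M] [Module k[G] M] [IsScalarTower k k[G] M]
  {N : Type max u v} [AddCommGroup N] [Module k[G] N]

/-- A module that is right orthogonal to the cofibrant quotients of one sufficiently large free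
module is right orthogonal to every cofibrant module. -/
theorem extOneVanishes_of_small [Module.Projective k[G] (DiagTensor β M)]
    (h : ∀ K : Submodule k[G] (List (B × ℕ) →₀ k[G]),
      Module.Projective k[G] (DiagTensor β ((List (B × ℕ) →₀ k[G]) ⧸ K)) →
        ExtOneVanishes k[G] ((List (B × ℕ) →₀ k[G]) ⧸ K) N) : ExtOneVanishes k[G] M N := by
  obtain ⟨s, hs⟩ := (Module.projective_def (R := k[G]) (P := DiagTensor β M)).1 inferInstance
  refine extOneVanishes_of_submodules (DiagTensor.SupportClosed s)
    (fun c hc => DiagTensor.SupportClosed.sSup hc) fun p hp hne => ?_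
  obtain ⟨x, -, hx⟩ := SetLike.exists_of_lt hne.lt_top
  obtain ⟨c, hxc, hc⟩ := DiagTensor.exists_supportClosed s x
  let q := p ⊔ Submodule.span k[G] (Set.range c)
  have hpq : p ≤ q := le_sup_left
  have hcq : Submodule.span k[G] (Set.range c) ≤ q := le_sup_right
  have hq : DiagTensor.SupportClosed s q := by
    rw [show q = sSup {p, Submodule.span k[G] (Set.range c)} from sSup_pair.symm]
    refine DiagTensor.SupportClosed.sSup ?_
    rintro _ (rfl | rfl)
    exacts [hp, hc]
  refine ⟨q, hq, lt_of_le_of_ne hpq fun heq => hx ?_, ?_⟩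
  · exact heq ▸ hcq (Submodule.subset_span hxc)
  have := hp.projective_quotient hs
  have := hq.projective_quotient hs
  -- `q / p` is the kernel of `M / p → M / q`.
  have hC : Module.Projective k[G] (DiagTensor β (q.map p.mkQ)) := by
    have hle : p ≤ q.comap LinearMap.id := hpq
    refine projective_diagTensor_of_exact (Submodule.injective_subtype (q.map p.mkQ))
      (p := p.mapQ q LinearMap.id hle) (fun y => ?_) fun y => ?_
    · obtain ⟨m, rfl⟩ := p.mkQ_surjective y
      rw [Submodule.mkQ_apply, Submodule.mapQ_apply, LinearMap.id_apply,
        Submodule.Quotient.mk_eq_zero]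
      simp only [Submodule.coe_subtype, Subtype.range_coe_subtype, Set.mem_ofPred_eq]
      refine ⟨fun hm => ⟨m, hm, rfl⟩, ?_⟩
      rintro ⟨m', hm', hmm'⟩
      have := hpq ((Submodule.Quotient.eq p).1 hmm')
      simpa using q.sub_mem hm' this
    · obtain ⟨m, rfl⟩ := q.mkQ_surjective y
      exact ⟨p.mkQ m, rfl⟩
  let φ : (List (B × ℕ) →₀ k[G]) →ₗ[k[G]] q.map p.mkQ :=
    Finsupp.linearCombination k[G] fun l =>
      ⟨p.mkQ (c l), Submodule.mem_map_of_mem (hcq (Submodule.subset_span ⟨l, rfl⟩))⟩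
  have hφ_comp : (q.map p.mkQ).subtype ∘ₗ φ = p.mkQ ∘ₗ Finsupp.linearCombination k[G] c := by
    ext l
    simp [φ]
  have hφ : Function.Surjective φ := by
    rintro ⟨_, m, hm, rfl⟩
    obtain ⟨a, ha, b, hb, rfl⟩ := Submodule.mem_sup.1 hm
    rw [← Finsupp.range_linearCombination] at hb
    obtain ⟨f, rfl⟩ := hb
    refine ⟨f, Subtype.ext ((LinearMap.congr_fun hφ_comp f).trans ?_)⟩
    simpa using ha
  refine extOneVanishes_of_exists_extension (Submodule.injective_subtype _)
    (LinearMap.exact_subtype_ker_map φ) hφ fun f => ?_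
  have := h (LinearMap.ker φ)
    (projective_diagTensor_of_equiv β (φ.quotKerEquivOfSurjective hφ).symm)
  exact this.exists_extension (Submodule.injective_subtype _)
    (LinearMap.exact_subtype_mkQ _) (Submodule.mkQ_surjective _) f

end Small

/-! ### Bounded functions -/

section Bounded

/-- Bounded integral functions on a set `G` are the locally constant functions on the space of
ultrafilters on `G`, the Stone–Čech compactification of the discrete space `G`; these form a free
abelian group by Nöbeling's theorem. -/
instance boundedFunctions_free (G : Type v) : Module.Free ℤ (boundedFunctions G) := by
  let S : Profinite := Profinite.of (Ultrafilter G)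
  let r : LocallyConstant S ℤ →ₗ[ℤ] boundedFunctions G :=
    { toFun := fun φ => ⟨fun x => φ (pure x), by
        obtain ⟨C, hC⟩ := (φ.range_finite.image abs).bddAbove
        exact ⟨C, fun x => hC ⟨_, ⟨_, rfl⟩, rfl⟩⟩⟩
      map_add' := fun _ _ => rfl
      map_smul' := fun _ _ => rfl }
  have hr : Function.Bijective r := by
    constructor
    · -- The principal ultrafilters are dense.
      intro φ ψ h
      have h' (x : G) : φ (pure x) = ψ (pure x) := congrFun (congrArg Subtype.val h) x
      refine LocallyConstant.coe_injective ?_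
      exact denseRange_pure.equalizer φ.continuous ψ.continuous (funext h')
    · -- A function with values in a finite interval extends to the ultrafilters.
      rintro ⟨f, C, hC⟩
      let f' : G → Set.Icc (-C) C := fun x => ⟨f x, abs_le.1 (hC x)⟩
      have hcont : Continuous fun u : Ultrafilter G => ((Ultrafilter.extend f' u : Set.Icc (-C) C) : ℤ) :=
        continuous_subtype_val.comp (continuous_ultrafilter_extend f')
      refine ⟨⟨_, (IsLocallyConstant.iff_continuous _).2 hcont⟩, Subtype.ext (funext fun x => ?_)⟩
      exact congrArg Subtype.val (congrFun (ultrafilter_extend_extends f') x)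
  have := LocallyConstant.freeOfProfinite S
  exact Module.Free.of_equiv (LinearEquiv.ofBijective r hr)

variable (k : Type u) [CommRing k] (G : Type v) [Group G]

/-- The constant function `1`. -/
def boundedOne : k ⊗[ℤ] boundedFunctions G := 1 ⊗ₜ ⟨1, 1, fun _ => by simp⟩

theorem boundedRep_boundedOne (g : G) : boundedRep k G g (boundedOne k G) = boundedOne k G :=
  rfl

/-- Evaluation at the identity element of `G`. -/
noncomputable def boundedEval : k ⊗[ℤ] boundedFunctions G →ₗ[k] k :=
  LinearMap.liftBaseChange k
    ((Algebra.linearMap ℤ k) ∘ₗ LinearMap.proj (1 : G) ∘ₗ (boundedFunctions G).subtype)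

theorem boundedEval_boundedOne : boundedEval k G (boundedOne k G) = 1 := by
  simp [boundedEval, boundedOne]

/-- The pointwise multiplication of bounded functions. -/
def boundedMulInt : boundedFunctions G →ₗ[ℤ] boundedFunctions G →ₗ[ℤ] boundedFunctions G :=
  LinearMap.mk₂ ℤ (fun f f' => ⟨f.1 * f'.1, by
      obtain ⟨C, hC⟩ := f.2
      obtain ⟨D, hD⟩ := f'.2
      refine ⟨C * D, fun x => ?_⟩
      rw [Pi.mul_apply, abs_mul]
      exact mul_le_mul (hC x) (hD x) (abs_nonneg _) ((abs_nonneg _).trans (hC x))⟩)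
    (fun _ _ _ => Subtype.ext (add_mul _ _ _)) (fun _ _ _ => Subtype.ext (smul_mul_assoc _ _ _))
    (fun _ _ _ => Subtype.ext (mul_add _ _ _)) (fun _ _ _ => Subtype.ext (mul_smul_comm _ _ _))

/-- The multiplication of the `k`-algebra `B(G, k)`. -/
noncomputable def boundedMul : k ⊗[ℤ] boundedFunctions G →ₗ[k] k ⊗[ℤ] boundedFunctions G →ₗ[k]
    k ⊗[ℤ] boundedFunctions G :=
  LinearMap.BilinMap.baseChange k (boundedMulInt G)

theorem boundedMul_boundedRep (g : G) (b b' : k ⊗[ℤ] boundedFunctions G) :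
    boundedMul k G (boundedRep k G g b) (boundedRep k G g b') =
      boundedRep k G g (boundedMul k G b b') := by
  have h : (boundedMul k G).compl₁₂ (boundedRep k G g) (boundedRep k G g) =
      (boundedMul k G).compr₂ (boundedRep k G g) := by
    ext f f'
    rfl
  exact LinearMap.congr_fun (LinearMap.congr_fun h b) b'

omit [Group G] in
theorem boundedMul_boundedOne (b : k ⊗[ℤ] boundedFunctions G) :
    boundedMul k G (boundedOne k G) b = b := by
  have h : boundedMul k G (boundedOne k G) = LinearMap.id := by
    ext f
    simp [boundedMul, boundedOne, boundedMulInt]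
  rw [h, LinearMap.id_apply]

end Bounded

/-! ### Cofibrant modules -/

noncomputable section Cof

variable {k : Type u} [CommRing k] {G : Type v} [Group G]

/-- The module in the definition of cofibrancy is the diagonal module `M ⊗ B(G, k)`. -/
theorem cof_iff (M : ModuleCat.{max u v} k[G]) [Module k M] [IsScalarTower k k[G] M] :
    Cof k G M ↔ Module.Projective k[G] (DiagTensor (boundedRep k G) M) := by
  let ρ := (Representation.ofModule (k := k) (G := G) M).tprod (boundedRep k G)
  let e₀ : RestrictScalars k k[G] M ≃ₗ[k] M :=
    { RestrictScalars.addEquiv k k[G] M with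
      map_smul' := fun c x => by
        change algebraMap k k[G] c • (RestrictScalars.addEquiv k k[G] M x) = _
        rw [algebraMap_smul]
        rfl }
  let f : ρ.asModule ≃ₗ[k] DiagTensor (boundedRep k G) M :=
    ρ.asModuleEquiv ≪≫ₗ TensorProduct.congr e₀ (LinearEquiv.refl k _) ≪≫ₗ
      (DiagTensor.equiv (boundedRep k G) M).symm
  let F : ρ.asModule →ₗ[k[G]] DiagTensor (boundedRep k G) M :=
    equivariantOfLinearOfComm f.toLinearMap fun g x => by
      apply (DiagTensor.equiv (boundedRep k G) M).injective
      rw [DiagTensor.equiv_single_smul]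
      change TensorProduct.congr e₀ (LinearEquiv.refl k _)
          (ρ.asModuleEquiv (single g (1 : k) • x)) = TensorProduct.map _ _
          (TensorProduct.congr e₀ (LinearEquiv.refl k _) (ρ.asModuleEquiv x))
      rw [asModuleEquiv_single_smul]
      induction ρ.asModuleEquiv x using TensorProduct.induction_on with
      | zero => simp only [map_zero]
      | tmul m b => rfl
      | add x y hx hy => simp only [map_add, hx, hy]
  let e : ρ.asModule ≃ₗ[k[G]] DiagTensor (boundedRep k G) M :=
    LinearEquiv.ofBijective F f.bijective
  refine ⟨fun h => ?_, fun h => Module.Projective.of_equiv e.symm⟩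
  have : Module.Projective k[G] ρ.asModule := h
  exact Module.Projective.of_equiv e

end Cof

section Cof

variable {k : Type u} [CommRing k] {G : Type v} [Group G]

theorem cof_of_iff (M : Type max u v) [AddCommGroup M] [Module k M] [Module k[G] M]
    [IsScalarTower k k[G] M] :
    Cof k G (ModuleCat.of k[G] M) ↔ Module.Projective k[G] (DiagTensor (boundedRep k G) M) :=
  cof_iff (ModuleCat.of k[G] M)

theorem cof_of_projective (P : Type max u v) [AddCommGroup P] [Module k[G] P]
    [Module.Projective k[G] P] : Cof k G (ModuleCat.of k[G] P) := by
  let := Module.compHom P (algebraMap k k[G])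
  have := isScalarTower_compHom (k := k) (G := G) P
  exact (cof_of_iff (k := k) (G := G) P).2 projective_diagTensor_of_projective.{u, v, max u v}

theorem rightOrthogonal_cof_of_forall {N : Type max u v} [AddCommGroup N] [Module k[G] N]
    (h : ∀ (M : Type max u v) [AddCommGroup M] [Module k M] [Module k[G] M]
      [IsScalarTower k k[G] M], Module.Projective k[G] (DiagTensor (boundedRep k G) M) →
        ExtOneVanishes k[G] M N) : rightOrthogonal (Cof k G) (ModuleCat.of k[G] N) := by
  intro M hM
  let := Module.compHom M (algebraMap k k[G])
  have := isScalarTower_compHom (k := k) (G := G) M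
  exact h M ((cof_iff (k := k) (G := G) M).1 hM)

theorem leftOrthogonal_rightOrthogonal_cof :
    leftOrthogonal (rightOrthogonal (Cof k G)) = Cof k G := by
  refine le_antisymm (fun M hM => ?_) fun M hM N hN => hN M hM
  let := Module.compHom M (algebraMap k k[G])
  have := isScalarTower_compHom (k := k) (G := G) M
  refine (cof_iff (k := k) (G := G) M).2 (projective_diagTensor_of_extOneVanishes.{u, v, max u v} fun N => hM _ ?_)
  exact rightOrthogonal_cof_of_forall.{u, v} fun M' _ _ _ _ _ => extOneVanishes_conjHom.{u, v, max u v} M' N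

/-- The kernel of a projective presentation of a cofibrant module is cofibrant, so that dimension
shifting applies. -/
theorem isHereditary_cof : IsHereditary (Cof k G) (rightOrthogonal (Cof k G)) := by
  intro M N hM hN i hi
  induction i, hi using Nat.le_induction generalizing M with
  | base => exact hN M hM
  | succ i _ ih =>
    obtain ⟨P, _, _, p, _, hp⟩ := exists_projective_presentation k[G] M
    have : Projective (ModuleCat.of k[G] P) :=
      (IsProjective.iff_projective (R := k[G]) P).1 inferInstance
    refine ext_succ_of_presentation (shortExact_ofHom (Submodule.injective_subtype _)
      (LinearMap.exact_subtype_ker_map p) hp) (ih (ModuleCat.of k[G] (LinearMap.ker p)) ?_)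
    let := Module.compHom M (algebraMap k k[G])
    have := isScalarTower_compHom (k := k) (G := G) M
    let := Module.compHom P (algebraMap k k[G])
    have := isScalarTower_compHom (k := k) (G := G) P
    have := (cof_iff (k := k) (G := G) M).1 hM
    have := (cof_of_iff (k := k) (G := G) P).1 (cof_of_projective (k := k) (G := G) P)
    exact (cof_of_iff (k := k) (G := G) _).2 (projective_diagTensor_of_exact (Submodule.injective_subtype _)
      (LinearMap.exact_subtype_ker_map p) hp)

theorem isProjectivePair_cof : IsProjectivePair (Cof k G) (rightOrthogonal (Cof k G)) := by
  intro M
  let := Module.compHom M (algebraMap k k[G])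
  have := isScalarTower_compHom (k := k) (G := G) M
  constructor
  · rintro ⟨hU, hV⟩
    have := (cof_iff (k := k) (G := G) M).1 hU
    exact projective_of_extOneVanishes_cofibrant.{u, v, max u v} (boundedRep_boundedOne k G)
      (boundedEval_boundedOne k G) (boundedMul_boundedRep k G) (boundedMul_boundedOne k G)
      fun C _ _ _ _ hC => hV _ ((cof_of_iff (k := k) (G := G) C).2 hC)
  · intro hM
    refine ⟨cof_of_projective (k := k) (G := G) M, rightOrthogonal_cof_of_forall.{u, v} fun C _ _ _ _ hC => ?_⟩
    exact extOneVanishes_of_projective_right.{u, v, max u v} (boundedRep_boundedOne k G)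
      (boundedEval_boundedOne k G)

variable (k G)

/-- The free module of which all test modules are quotients. -/
abbrev TestFree : Type max u v := List ((k ⊗[ℤ] boundedFunctions G) × ℕ) →₀ k[G]

/-- The index set of the test modules, which are the cofibrant quotients of `TestFree k G`. -/
abbrev TestIndex : Type max u v :=
  {K : Submodule k[G] (TestFree k G) // Cof k G (ModuleCat.of k[G] (TestFree k G ⧸ K))}

theorem rightOrthogonal_test : rightOrthogonal (Cof k G) = rightOrthogonal
    (ObjectProperty.ofObj fun K : TestIndex k G => ModuleCat.of k[G] (TestFree k G ⧸ K.1)) := by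
  refine le_antisymm (fun N hN => ?_) fun N hN => ?_
  · rintro _ ⟨K⟩
    exact hN _ K.2
  · refine rightOrthogonal_cof_of_forall (N := N) fun M _ _ _ _ hM => ?_
    exact extOneVanishes_of_small (β := boundedRep k G) fun K hK =>
      hN _ (ObjectProperty.ofObj_apply _ (⟨K, (cof_of_iff (k := k) (G := G) _).2 hK⟩ : TestIndex k G))

theorem isComplete_cof : IsComplete (Cof k G) (rightOrthogonal (Cof k G)) := by
  let S (K : TestIndex k G) : ShortComplex (ModuleCat.{max u v} k[G]) :=
    shortComplexOfExact (A := K.1) (C := TestFree k G ⧸ K.1) (i := K.1.subtype) (p := K.1.mkQ)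
      (LinearMap.exact_subtype_mkQ K.1)
  have hS (K) : (S K).ShortExact :=
    shortExact_ofHom K.1.injective_subtype (LinearMap.exact_subtype_mkQ K.1) K.1.mkQ_surjective
  have hP (K) : Projective (S K).X₂ :=
    (IsProjective.iff_projective (R := k[G]) (TestFree k G)).1 inferInstance
  have hV (N : ModuleCat.{max u v} k[G]) :
      rightOrthogonal (Cof k G) N ↔ ∀ K, Subsingleton (Abelian.Ext (S K).X₃ N 1) := by
    rw [rightOrthogonal_test]
    refine ⟨fun h K => h _ (ObjectProperty.ofObj_apply _ K), ?_⟩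
    rintro h _ ⟨K⟩
    exact h K
  have hU (A : ModuleCat.{max u v} k[G]) (hA : ∀ N : ModuleCat.{max u v} k[G],
      (∀ K, Subsingleton (Abelian.Ext (S K).X₃ N 1)) → Subsingleton (Abelian.Ext A N 1)) :
      Cof k G A := by
    rw [← leftOrthogonal_rightOrthogonal_cof]
    exact fun N hN => hA N ((hV N).1 hN)
  intro M
  constructor
  · obtain ⟨T, hT, rfl, h₁, h₂⟩ := exists_leftOrthogonal_cover S hS M
    exact ⟨T.X₂, T.X₁, T.f, T.g, T.zero, hU _ h₂, (hV _).2 h₁, hT⟩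
  · obtain ⟨T, hT, rfl, h₁, h₂⟩ := exists_rightOrthogonal_embedding S hS M
    exact ⟨T.X₃, T.X₂, T.f, T.g, T.zero, hU _ h₂, (hV _).2 h₁, hT⟩

end Cof

end CotorsionPairs

theorem theorem3p3 (k : Type u) [CommRing k] (G : Type v) [Group G] :
    CotorsionPairs.IsCotorsionPair (CotorsionPairs.Cof k G)
        (CotorsionPairs.rightOrthogonal (CotorsionPairs.Cof k G)) ∧
      CotorsionPairs.IsHereditary (CotorsionPairs.Cof k G)
        (CotorsionPairs.rightOrthogonal (CotorsionPairs.Cof k G)) ∧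
      CotorsionPairs.IsProjectivePair (CotorsionPairs.Cof k G)
        (CotorsionPairs.rightOrthogonal (CotorsionPairs.Cof k G)) ∧
      CotorsionPairs.IsCogeneratedBySet (CotorsionPairs.Cof k G)
        (CotorsionPairs.rightOrthogonal (CotorsionPairs.Cof k G)) ∧
      CotorsionPairs.IsComplete (CotorsionPairs.Cof k G)
        (CotorsionPairs.rightOrthogonal (CotorsionPairs.Cof k G)) := by
  open CotorsionPairs in
  exact ⟨⟨leftOrthogonal_rightOrthogonal_cof.symm, rfl⟩, isHereditary_cof, isProjectivePair_cof,
    ⟨TestIndex k G, _, rightOrthogonal_test k G, by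
      rw [← rightOrthogonal_test, leftOrthogonal_rightOrthogonal_cof]⟩, isComplete_cof k G⟩
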